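/- Let $\mathbb T=\mathbb R/\mathbb Z$ with Lebesgue probability measure $\mu_0$, let $p\ge 2$ be an integer and $f_p(x)=px \pmod 1$. For a word $w=i_0\cdots i_{n-1}$ with letters in $\{0,\dots,p-1\}$ let $I_w\subset\mathbb T$ be the closed arc $[a_w,a_w+p^{-n}]$ with $a_w=\sum_{k=0}^{n-1} i_k p^{-(k+1)}$. A non-atomic Borel probability measure $\mu$ of full support on $\mathbb T$ is called $p$-invariant if $\mu(f_p^{-1}(A))=\mu(A)$ for all Borel sets $A$, and it is said to have balanced geometry if there is a constant $C_0>0$ such that $$\frac{\sum_{j\neq i}\mu(I_{jw})}{\mu(I_{iw})}\ge C_0$$ for every nonempty finite word $w$ and every $0\le i\le p-1$. Let $0<\alpha\le 1$ and let $f:\mathbb T\to\mathbb T$ be a $C^{1+\alpha}$ expanding circle endomorphism of degree $p$; that is, $f$ is a covering map of degree $p$ with an $\alpha$-Hölder continuous derivative, and there are constants $D>0$, $\lambda>1$ with $|(f^n)'(x)|\ge D\lambda^n$ for all $x\in\mathbb T$ and all $n\ge 0$. Then: 1. There is a positive $\alpha$-Hölder continuous function $\rho$ on $\mathbb T$ such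 that $\nu(A)=\int_A\rho\,dx$ is an $f$-invariant probability measure. 2. For every such $\rho$, the formula $h_0(x)=\int_0^x\rho(t)\,dt \pmod 1$ defines a homeomorphism of $\mathbb T$, the map $g=h_0\circ f\circ h_0^{-1}$ preserves $\mu_0$, and there is a homeomorphism $h$ of $\mathbb T$ with $g\circ h=h\circ f_p$. 3. For every such $\rho$, with $g$ as in 2, and for every homeomorphism $h$ of $\mathbb T$ with $g\circ h=h\circ f_p$, the measure $\mu=(h^{-1})_*\mu_0$, that is $\mu(A)=\mu_0(h(A))$, is a non-atomic Borel probability measure of full support which is $p$-invariant and has balanced geometry. -/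

import Mathlib

open MeasureTheory

namespace CircleMaps

/-- The unit circle `𝕋 = ℝ / ℤ`, with its Lebesgue probability measure `volume` and the arc-length
distance. -/
abbrev T : Type := UnitAddCircle

/-! ### Measures on the circle, the `p`-action and its cylinder intervals -/

/-- The `p`-action `x ↦ p x (mod 1)`. -/
def pMap (p : ℕ) : T → T := fun x => p • x

/-- A non-atomic Borel probability measure with full support. -/
structure IsFullNonatomicProbability (μ : Measure T) : Prop where
  probability : μ Set.univ = 1
  nonatomic : ∀ x : T, μ {x} = 0
  fullSupport : ∀ U : Set T, IsOpen U → U.Nonempty → 0 < μ U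

/-- `μ` is `p`-invariant. -/
def IsPInvariant (p : ℕ) (μ : Measure T) : Prop :=
  ∀ A : Set T, MeasurableSet A → μ (pMap p ⁻¹' A) = μ A

/-- The left endpoint `0.i₀ i₁ … i_{n-1}` (in base `p`) of the interval coded by the word
`w = i₀ i₁ … i_{n-1}`. -/
noncomputable def leftEndpoint (p : ℕ) {n : ℕ} (w : Fin n → Fin p) : ℝ :=
  ∑ k : Fin n, ((w k : ℕ) : ℝ) / (p : ℝ) ^ ((k : ℕ) + 1)

/-- The interval `I_w` of the `n`-th partition: the closed arc of length `p⁻ⁿ` whose points have a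
base-`p` expansion starting with the word `w`. For words of length one it is `[i/p, (i+1)/p]`,
and `pMap p` maps `I_{i₀ i₁ … i_{n-1}}` onto `I_{i₁ … i_{n-1}}`. -/
def cylinder (p : ℕ) {n : ℕ} (w : Fin n → Fin p) : Set T :=
  (fun x : ℝ => (x : T)) ''
    Set.Icc (leftEndpoint p w) (leftEndpoint p w + 1 / (p : ℝ) ^ n)

/-- The word `i w`, obtained by putting the letter `i` in front of the word `w`. -/
def prependLetter {p n : ℕ} (i : Fin p) (w : Fin n → Fin p) : Fin (n + 1) → Fin p :=
  Fin.cons i w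

/-- `μ` has balanced geometry with respect to the `p`-action: for some `C₀ > 0`, every nonempty
word `w` and every letter `i`, the ratio of `∑_{j ≠ i} μ(I_{jw})` to `μ(I_{iw})` is at least
`C₀`. -/
def HasBalancedGeometry (p : ℕ) (μ : Measure T) : Prop :=
  ∃ C₀ : ℝ, 0 < C₀ ∧ ∀ n : ℕ, 1 ≤ n → ∀ (w : Fin n → Fin p) (i : Fin p),
    C₀ ≤ (∑ j ∈ Finset.univ.erase i, μ.real (cylinder p (prependLetter j w))) /
      μ.real (cylinder p (prependLetter i w))

/-! ### Circle endomorphisms -/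

/-- `F : ℝ → ℝ` is a lift of the circle map `f`. -/
def IsLift (F : ℝ → ℝ) (f : T → T) : Prop :=
  Continuous F ∧ ∀ x : ℝ, ((F x : ℝ) : T) = f (x : T)

/-- `f` is a circle endomorphism of degree `p`, i.e. a covering map of the circle of degree `p`. -/
def IsCircleEndomorphism (p : ℕ) (f : T → T) : Prop :=
  IsCoveringMap f ∧ ∃ F : ℝ → ℝ, IsLift F f ∧ ∀ x : ℝ, F (x + 1) = F x + p

/-- `f' : 𝕋 → ℝ` is the derivative of the circle map `f`. (Two lifts of `f` differ by a constant, so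
the choice of the lift does not matter.) -/
def HasCircleDeriv (f : T → T) (f' : T → ℝ) : Prop :=
  ∃ F : ℝ → ℝ, IsLift F f ∧ ∀ x : ℝ, HasDerivAt F (f' (x : T)) x

/-- `φ : 𝕋 → ℝ` is `α`-Hölder continuous. -/
def IsHolder (α : ℝ) (φ : T → ℝ) : Prop :=
  ∃ d D : ℝ, 0 < d ∧ d < 1 ∧ 0 < D ∧
    ∀ x y : T, dist x y < d → |φ x - φ y| ≤ D * dist x y ^ α

/-- `f` is of class `C^{1+α}`. -/
def IsC1Holder (α : ℝ) (f : T → T) : Prop :=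
  ∃ f' : T → ℝ, HasCircleDeriv f f' ∧ Continuous f' ∧ IsHolder α f'

/-- `f` is expanding: `|(fⁿ)'(x)| ≥ D λⁿ` for constants `D > 0`, `λ > 1`. -/
def IsExpanding (f : T → T) : Prop :=
  ∃ D l : ℝ, 0 < D ∧ 1 < l ∧ ∀ n : ℕ,
    ∃ φ : T → ℝ, HasCircleDeriv (f^[n]) φ ∧ ∀ x : T, D * l ^ n ≤ |φ x|

/-! ### The invariant density and the conjugacies -/

/-- The measure `ν(A) = ∫_A ρ(x) dx`. -/
noncomputable def densityMeasure (ρ : T → ℝ) : Measure T :=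
  (volume : Measure T).withDensity (fun x => ENNReal.ofReal (ρ x))

/-- `ρ` is a positive `α`-Hölder continuous density of an `f`-invariant probability measure. -/
structure IsInvariantDensity (α : ℝ) (f : T → T) (ρ : T → ℝ) : Prop where
  pos : ∀ x : T, 0 < ρ x
  holder : IsHolder α ρ
  probability : densityMeasure ρ Set.univ = 1
  invariant : ∀ A : Set T, MeasurableSet A →
    densityMeasure ρ (f ⁻¹' A) = densityMeasure ρ A

/-- `h₀` is the circle map given by the formula `h₀(x) = ∫₀ˣ ρ(t) dt (mod 1)`. -/
def IsDensityCoordinate (ρ : T → ℝ) (h₀ : T → T) : Prop :=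
  ∀ x : ℝ, h₀ (x : T) = ((∫ t in (0 : ℝ)..x, ρ (t : T) : ℝ) : T)

end CircleMaps

open CircleMaps

/-! ### Circle maps and their lifts to the line -/

namespace CircleMaps

/-! Everything is lifted to the line, where f becomes an increasing F with F(x + 1) = F(x) + p.

Density: let G be the inverse of F. Since Gⁿ contracts exponentially and F' is Hölder, the
distortions of the successive factors of (Gⁿ)' form a geometric series, so (Gⁿ)'(x) ≤ exp(K|x -
y|^α) (Gⁿ)'(y) uniformly in n (`exists_distortion`). Hence the transfer operator's iterates on the
constant 1 stay between positive constants and have uniformly Hölder logarithms. A limit of their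
Cesàro means is a fixed point with the same bounds; normalized, it is the invariant density ρ.

Conjugacy: Φ = lim Fⁿ/pⁿ satisfies Φ ∘ F = pΦ, and expansion makes it injective. It descends to a
circle homeomorphism φ conjugating f to x ↦ px, and h = h₀ ∘ φ⁻¹ conjugates x ↦ px to g.

Balanced geometry: since F is Lipschitz and ρ lies between positive constants, ν(f(E)) ≤ L ν(E)
(`exists_densityMeasure_image_le`). For any conjugacy h, the map h₀⁻¹ ∘ h carries μ to ν and the
p-action to f, so the p-action also expands μ by a factor at most L. As it maps each I_{jw} onto
I_w, invariance gives μ(I_{iw}) ≤ μ(I_w) ≤ L μ(I_{jw}), and a single j ≠ i yields C₀ = 1/L. -/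

lemma map_add_int_of_map_add_one {F : ℝ → ℝ} {d : ℝ} (hF : ∀ x, F (x + 1) = F x + d) (x : ℝ)
    (n : ℤ) : F (x + n) = F x + n * d := by
  have hper : Function.Periodic (fun y => F y - d * y) 1 := fun y => by
    simp only [hF]; ring
  have := hper.int_mul n x
  simp only [mul_one] at this
  linarith

lemma surjective_of_map_add_one {F : ℝ → ℝ} {d : ℝ} (hd : 0 < d) (hc : Continuous F)
    (hF : ∀ x, F (x + 1) = F x + d) : Function.Surjective F := by
  intro y
  have hn := fun n : ℤ => map_add_int_of_map_add_one hF 0 n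
  refine mem_range_of_exists_le_of_exists_ge hc
    ⟨0 + (⌊(y - F 0) / d⌋ : ℤ), ?_⟩ ⟨0 + (⌈(y - F 0) / d⌉ : ℤ), ?_⟩
  · rw [hn]
    have := (le_div_iff₀ hd).1 (Int.floor_le ((y - F 0) / d))
    linarith
  · rw [hn]
    have := (div_le_iff₀ hd).1 (Int.le_ceil ((y - F 0) / d))
    linarith

lemma coe_eq_coe_iff {x y : ℝ} : (x : T) = (y : T) ↔ ∃ n : ℤ, x = y + n := by
  rw [← sub_eq_zero, ← AddCircle.coe_sub, AddCircle.coe_eq_zero_iff]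
  refine exists_congr fun n => ?_
  rw [zsmul_one]
  constructor <;> intro h <;> linarith

/-- An increasing homeomorphism of the line commuting with the unit translation descends to a
homeomorphism of the circle. -/
lemma exists_homeomorph_of_lift {Φ : ℝ → ℝ} (hc : Continuous Φ) (hm : StrictMono Φ)
    (h1 : ∀ x, Φ (x + 1) = Φ x + 1) : ∃ φ : T ≃ₜ T, ∀ x : ℝ, φ x = (Φ x : T) := by
  have hper : Function.Periodic (fun x : ℝ => (Φ x : T)) 1 := fun x => by
    simp only [h1]; exact AddCircle.coe_add_period 1 _
  have hcont : Continuous (hper.lift : T → T) :=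
    continuous_coinduced_dom.2 ((AddCircle.continuous_mk' 1).comp hc)
  have hval : ∀ x : ℝ, hper.lift (x : T) = (Φ x : T) := fun x => hper.lift_coe x
  have hbij : Function.Bijective (hper.lift : T → T) := by
    constructor
    · intro a b
      induction a using QuotientAddGroup.induction_on with | H x => ?_
      induction b using QuotientAddGroup.induction_on with | H y => ?_
      intro h
      have h' : (Φ x : T) = (Φ y : T) := h
      obtain ⟨n, hn⟩ := coe_eq_coe_iff.1 h'
      have := map_add_int_of_map_add_one h1 y n
      rw [mul_one, ← hn] at this
      exact coe_eq_coe_iff.2 ⟨n, hm.injective this.symm⟩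
    · intro b
      induction b using QuotientAddGroup.induction_on with | H y => ?_
      obtain ⟨x, hx⟩ := surjective_of_map_add_one one_pos hc h1 y
      exact ⟨(x : T), by rw [hval, hx]⟩
  exact ⟨hcont.homeoOfEquivCompactToT2 (f := Equiv.ofBijective _ hbij), hval⟩

/-- The values at 0 differ by an integer; after translating by it, uniqueness of lifts through the
covering ℝ → 𝕋 applies. -/
lemma IsLift.eq_add_const {F₁ F₂ : ℝ → ℝ} {f : T → T} (h₁ : IsLift F₁ f) (h₂ : IsLift F₂ f) :
    ∃ c : ℝ, ∀ x, F₁ x = F₂ x + c := by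
  obtain ⟨n, hn⟩ := coe_eq_coe_iff.1 ((h₁.2 0).trans (h₂.2 0).symm)
  refine ⟨n, fun x => ?_⟩
  refine congrFun ((AddCircle.isCoveringMap_coe (1 : ℝ)).eq_of_comp_eq h₁.1
    (h₂.1.add continuous_const) (funext fun y => ?_) 0 hn) x
  have : (F₁ y : T) = ((F₂ y + n : ℝ) : T) := by
    rw [h₁.2, ← h₂.2]; exact coe_eq_coe_iff.2 ⟨-n, by push_cast; ring⟩
  exact this

lemma HasCircleDeriv.hasDerivAt {F : ℝ → ℝ} {f : T → T} {f' : T → ℝ} (h : HasCircleDeriv f f')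
    (hF : IsLift F f) (x : ℝ) : HasDerivAt F (f' x) x := by
  obtain ⟨F₂, hF₂, hd⟩ := h
  obtain ⟨c, hc⟩ := hF.eq_add_const hF₂
  rw [funext hc]
  exact (hd x).add_const c

lemma IsLift.iterate {F : ℝ → ℝ} {f : T → T} (h : IsLift F f) (n : ℕ) : IsLift F^[n] f^[n] := by
  refine ⟨h.1.iterate n, fun x => ?_⟩
  have hs : Function.Semiconj (fun y : ℝ => (y : T)) F f := h.2
  exact (hs.iterate_right n) x

/-! ### Expanding lifts -/

/-- `F` is an increasing lift, with derivative `F'`, of the expanding circle endomorphism `f` of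
degree `p` and class `C^{1+α}`. -/
structure ExpandingLift (p : ℕ) (α : ℝ) (f : T → T) (F F' : ℝ → ℝ) : Prop where
  coe_lift : ∀ x : ℝ, ((F x : ℝ) : T) = f (x : T)
  map_add_one : ∀ x, F (x + 1) = F x + p
  hasDerivAt : ∀ x, HasDerivAt F (F' x) x
  deriv_add_one : ∀ x, F' (x + 1) = F' x
  deriv_continuous : Continuous F'
  deriv_bounds : ∃ m M : ℝ, 0 < m ∧ ∀ x, m ≤ F' x ∧ F' x ≤ M
  deriv_holder : ∃ C : ℝ, 0 ≤ C ∧ ∀ x y, |F' x - F' y| ≤ C * |x - y| ^ α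
  expanding : ∃ D l : ℝ, 0 < D ∧ 1 < l ∧ ∀ (n : ℕ) (x y : ℝ), x ≤ y →
    D * l ^ n * (y - x) ≤ F^[n] y - F^[n] x

lemma dist_coe_le (x y : ℝ) : dist (x : T) (y : T) ≤ |x - y| := by
  rw [dist_eq_norm, ← AddCircle.coe_sub, UnitAddCircle.norm_eq]
  simpa using round_le (x - y) 0

/-- Expansion at n = 1 keeps F' away from 0, so F' has constant sign; the mean slope of F over [0,
1] is p > 0, so the sign is positive. Lifts of fⁿ differ by constants, so the derivative bounds for
fⁿ hold for Fⁿ. -/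
lemma exists_expandingLift {p : ℕ} (hp : 0 < p) {α : ℝ} (hα : 0 < α) {f : T → T}
    (hf : IsCircleEndomorphism p f) (hfC : IsC1Holder α f) (hfE : IsExpanding f) :
    ∃ F F' : ℝ → ℝ, ExpandingLift p α f F F' := by
  obtain ⟨-, F, hF, hdeg⟩ := hf
  obtain ⟨f', hder, hcont, d, C, hd0, -, hC, hhol⟩ := hfC
  obtain ⟨D, l, hD, hl, hexp⟩ := hfE
  have hderF : ∀ x : ℝ, HasDerivAt F (f' x) x := hder.hasDerivAt hF
  have hcoe : Continuous (fun x : ℝ => (x : T)) := AddCircle.continuous_mk' 1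
  have hcF' : Continuous (fun x : ℝ => f' (x : T)) := hcont.comp hcoe
  have hdiffn : ∀ (n : ℕ) (x : ℝ), ∃ a : ℝ, D * l ^ n ≤ |a| ∧ HasDerivAt F^[n] a x := by
    intro n x
    obtain ⟨φ, h, hφ⟩ := hexp n
    exact ⟨φ x, hφ x, h.hasDerivAt (hF.iterate n) x⟩
  have hm : ∀ x : ℝ, D * l ≤ |f' x| := by
    intro x
    obtain ⟨a, ha, h⟩ := hdiffn 1 x
    rw [Function.iterate_one] at h
    rwa [pow_one, h.unique (hderF x)] at ha
  have hDl : 0 < D * l := by positivity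
  obtain ⟨c, -, hc⟩ := exists_hasDerivAt_eq_slope F (fun x => f' (x : T)) zero_lt_one
    hF.1.continuousOn (fun x _ => hderF x)
  have hcpos : 0 < f' (c : T) := by
    have h1 := hdeg 0
    rw [zero_add] at h1
    rw [hc, h1]
    simpa using hp
  have hpos : ∀ x : ℝ, 0 < f' (x : T) := by
    intro x
    by_contra! hx
    obtain ⟨z, hz⟩ := mem_range_of_exists_le_of_exists_ge hcF' ⟨x, hx⟩ ⟨c, hcpos.le⟩
    have := hm z
    simp only [hz, abs_zero] at this
    linarith
  obtain ⟨M, hM⟩ := isCompact_univ.exists_bound_of_continuousOn (f := f') hcont.continuousOn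
  have hM0 : 0 ≤ M := (norm_nonneg _).trans (hM 0 trivial)
  have hmono : StrictMono F := strictMono_of_deriv_pos fun x => by rw [(hderF x).deriv]; exact hpos x
  refine ⟨F, fun x => f' (x : T), hF.2, hdeg, hderF, ?_, hcF', ⟨D * l, M, hDl, ?_⟩, ?_,
    ⟨D, l, hD, hl, ?_⟩⟩
  · intro x
    rw [show ((x + 1 : ℝ) : T) = x from AddCircle.coe_add_period 1 x]
  · intro x
    refine ⟨?_, (le_abs_self _).trans (hM _ trivial)⟩
    have := hm x
    rwa [abs_of_pos (hpos x)] at this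
  · have hdα : 0 < d ^ α := Real.rpow_pos_of_pos hd0 α
    -- The Hölder bound is only given at distance below d; beyond it, |F'| ≤ M gives a difference of
    -- at most 2M, absorbed by the second summand.
    refine ⟨C + 2 * M / d ^ α, by positivity, fun x y => ?_⟩
    have hr : 0 ≤ |x - y| ^ α := by positivity
    rcases lt_or_ge |x - y| d with h | h
    · have h1 := dist_coe_le x y
      calc _ ≤ C * dist (x : T) (y : T) ^ α := hhol _ _ (h1.trans_lt h)
        _ ≤ C * |x - y| ^ α := by gcongr
        _ ≤ _ := by
          gcongr
          have : 0 ≤ 2 * M / d ^ α := by positivity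
          linarith
    · have h1 : d ^ α ≤ |x - y| ^ α := by gcongr
      have hx := hM x trivial
      have hy := hM y trivial
      rw [Real.norm_eq_abs] at hx hy
      calc _ ≤ 2 * M := by linarith [abs_sub (f' x) (f' y)]
        _ = 2 * M / d ^ α * d ^ α := by field_simp
        _ ≤ 2 * M / d ^ α * |x - y| ^ α := by gcongr
        _ ≤ _ := by gcongr; linarith
  · intro n x y hxy
    have hdiff : Differentiable ℝ F^[n] := fun z => by
      obtain ⟨a, -, h⟩ := hdiffn n z
      exact h.differentiableAt
    refine mul_sub_le_image_sub_of_le_deriv hdiff (fun z => ?_) hxy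
    obtain ⟨a, ha, h⟩ := hdiffn n z
    have h0 : 0 ≤ deriv F^[n] z := (hmono.monotone.iterate n).deriv_nonneg
    rw [h.deriv] at h0 ⊢
    rwa [abs_of_nonneg h0] at ha

/-! ### Topological conjugacy with multiplication by p -/

namespace ExpandingLift

variable {p : ℕ} {α : ℝ} {f : T → T} {F F' : ℝ → ℝ}

lemma deriv_pos (h : ExpandingLift p α f F F') (x : ℝ) : 0 < F' x := by
  obtain ⟨m, M, hm, hb⟩ := h.deriv_bounds
  exact hm.trans_le (hb x).1

lemma continuous (h : ExpandingLift p α f F F') : Continuous F :=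
  continuous_iff_continuousAt.2 fun x => (h.hasDerivAt x).continuousAt

lemma strictMono (h : ExpandingLift p α f F F') : StrictMono F :=
  strictMono_of_deriv_pos fun x => by rw [(h.hasDerivAt x).deriv]; exact h.deriv_pos x

/-- The linearization `lim Fⁿ(x) / pⁿ` of an expanding lift `F`. -/
lemma exists_linearization (h : ExpandingLift p α f F F') (hp : 2 ≤ p) :
    ∃ Φ : ℝ → ℝ, Continuous Φ ∧ StrictMono Φ ∧ (∀ x, Φ (x + 1) = Φ x + 1) ∧
      ∀ x, Φ (F x) = p * Φ x := by
  have hp1 : (1 : ℝ) < p := by exact_mod_cast hp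
  have hp0 : (0 : ℝ) < p := by linarith
  have hper : Function.Periodic (fun y => F y - p * y) 1 := fun y => by
    simp only [h.map_add_one]; ring
  have hcont : Continuous (fun y => F y - p * y) := h.continuous.sub (by fun_prop)
  obtain ⟨B, hB⟩ : ∃ B, ∀ y, |F y - p * y| ≤ B := by
    obtain ⟨B, hB⟩ := (hper.isBounded_of_continuous one_ne_zero hcont).exists_norm_le
    exact ⟨B, fun y => hB _ ⟨y, rfl⟩⟩
  have hiter : ∀ (n : ℕ) (x : ℝ), F^[n] (x + 1) = F^[n] x + (p : ℝ) ^ n := by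
    intro n
    induction n with
    | zero => simp
    | succ n ih =>
      intro x
      rw [Function.iterate_succ_apply', Function.iterate_succ_apply', ih]
      have := map_add_int_of_map_add_one h.map_add_one (F^[n] x) ((p : ℤ) ^ n)
      push_cast at this
      rw [this, pow_succ]
  -- These are the increments of Fⁿ(x)/pⁿ. As F(y) - py is periodic, hence bounded, they are
  -- dominated by a geometric series, and the limit is continuous.
  set e : ℕ → ℝ → ℝ := fun n x => (F (F^[n] x) - p * F^[n] x) / (p : ℝ) ^ (n + 1) with he
  have hsumm : Summable fun n : ℕ => B / (p : ℝ) ^ (n + 1) := by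
    have h1 : Summable fun n : ℕ => ((p : ℝ)⁻¹) ^ n :=
      summable_geometric_of_lt_one (by positivity) (inv_lt_one_of_one_lt₀ hp1)
    refine (h1.mul_left (B / p)).congr fun n => ?_
    rw [pow_succ, inv_pow]
    field_simp
  have hbound : ∀ (n : ℕ) (x : ℝ), ‖e n x‖ ≤ B / (p : ℝ) ^ (n + 1) := by
    intro n x
    rw [Real.norm_eq_abs, abs_div, abs_of_pos (by positivity : (0 : ℝ) < (p : ℝ) ^ (n + 1))]
    gcongr
    exact hB _
  have hsum : ∀ x, Summable fun n => e n x := fun x =>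
    Summable.of_norm_bounded hsumm fun n => hbound n x
  have hpartial : ∀ (x : ℝ) (n : ℕ),
      x + ∑ k ∈ Finset.range n, e k x = F^[n] x / (p : ℝ) ^ n := by
    intro x n
    induction n with
    | zero => simp
    | succ n ih =>
      rw [Finset.sum_range_succ, ← add_assoc, ih, he, Function.iterate_succ_apply', pow_succ]
      field_simp
      ring
  have hlim : ∀ x, Filter.Tendsto (fun n => F^[n] x / (p : ℝ) ^ n) Filter.atTop
      (nhds (x + ∑' n, e n x)) := fun x =>
    ((hsum x).hasSum.tendsto_sum_nat.const_add x).congr (hpartial x)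
  have hΦc : Continuous fun x => x + ∑' n, e n x := by
    refine continuous_id.add (continuous_tsum (fun n => ?_) hsumm hbound)
    have := h.continuous.iterate n
    have := h.continuous
    fun_prop
  have hΦ1 : ∀ x, (x + 1) + ∑' n, e n (x + 1) = (x + ∑' n, e n x) + 1 := by
    intro x
    refine tendsto_nhds_unique (hlim (x + 1)) (((hlim x).add_const 1).congr fun n => ?_)
    rw [hiter]
    field_simp
  have hΦF : ∀ x, F x + ∑' n, e n (F x) = p * (x + ∑' n, e n x) := by
    intro x
    refine tendsto_nhds_unique (hlim (F x))
      ((((hlim x).comp (Filter.tendsto_add_atTop_nat 1)).const_mul (p : ℝ)).congr fun n => ?_)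
    simp only [Function.comp_apply, Function.iterate_succ_apply, pow_succ]
    field_simp
  have hΦm : Monotone fun x => x + ∑' n, e n x := by
    intro x y hxy
    refine le_of_tendsto_of_tendsto' (hlim x) (hlim y) fun n => ?_
    have := h.strictMono.monotone.iterate n hxy
    gcongr
  refine ⟨fun x => x + ∑' n, e n x, hΦc, hΦm.strictMono_of_injective ?_, hΦ1, hΦF⟩
  generalize hΦ : (fun x => x + ∑' n, e n x) = Φ at hΦm
  have hΦ1 : ∀ x, Φ (x + 1) = Φ x + 1 := fun x => by rw [← hΦ]; exact hΦ1 x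
  have hΦF : ∀ x, Φ (F x) = p * Φ x := fun x => by rw [← hΦ]; exact hΦF x
  have hΦn : ∀ n x, Φ (F^[n] x) = (p : ℝ) ^ n * Φ x := by
    intro n
    induction n with
    | zero => simp
    | succ n ih => intro x; rw [Function.iterate_succ_apply, ih, hΦF, pow_succ, mul_assoc]
  -- Expansion eventually pushes Fⁿ(x) and Fⁿ(y) at least 1 apart, so Φ separates them by at least
  -- 1; but equal values of Φ at x and y would stay equal after multiplication by pⁿ.
  have hlt : ∀ x y, x < y → Φ x ≠ Φ y := by
    intro x y hxy heq
    obtain ⟨D, l, hD, hl, hexp⟩ := h.expanding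
    have hxy' : 0 < D * (y - x) := mul_pos hD (sub_pos.2 hxy)
    obtain ⟨n, hn⟩ := pow_unbounded_of_one_lt (1 / (D * (y - x))) hl
    have h1 := hexp n x y hxy.le
    rw [div_lt_iff₀ hxy'] at hn
    have h2 : F^[n] x + 1 ≤ F^[n] y := by linarith
    have h3 := hΦm h2
    rw [hΦ1, hΦn, hΦn, heq] at h3
    linarith
  intro x y hxy
  rcases lt_trichotomy x y with h' | h' | h'
  · exact absurd hxy (hlt _ _ h')
  · exact h'
  · exact absurd hxy.symm (hlt _ _ h')

/-- A circle map with an expanding lift is topologically conjugate to `x ↦ p x`. -/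
lemma exists_conjugacy (h : ExpandingLift p α f F F') (hp : 2 ≤ p) :
    ∃ φ : T ≃ₜ T, ∀ x, φ (f x) = pMap p (φ x) := by
  obtain ⟨Φ, hc, hm, h1, hF⟩ := h.exists_linearization hp
  obtain ⟨φ, hφ⟩ := exists_homeomorph_of_lift hc hm h1
  refine ⟨φ, fun x => ?_⟩
  induction x using QuotientAddGroup.induction_on with | H x => ?_
  rw [← h.coe_lift, hφ, hφ, hF, pMap, ← nsmul_eq_mul, AddCircle.coe_nsmul]

end ExpandingLift

/-! ### The inverse lift and its distortion -/

/-- `G` is the inverse of an expanding lift of degree `p`, and `G'` its derivative; the iterates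
of `G` have bounded distortion. -/
structure ContractingInverse (p : ℕ) (α : ℝ) (F G G' : ℝ → ℝ) : Prop where
  right_inv : ∀ x, F (G x) = x
  left_inv : ∀ x, G (F x) = x
  map_add : ∀ x, G (x + p) = G x + 1
  hasDerivAt : ∀ x, HasDerivAt G (G' x) x
  deriv_continuous : Continuous G'
  deriv_pos : ∀ x, 0 < G' x
  deriv_add : ∀ x, G' (x + p) = G' x
  distortion : ∃ c r : ℝ, 0 ≤ c ∧ 0 ≤ r ∧ r < 1 ∧ ∀ (n : ℕ) (x y : ℝ),
    G' (G^[n] x) ≤ Real.exp (c * r ^ n * |x - y| ^ α) * G' (G^[n] y)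

/-- The lower bound m on F' turns its Hölder bound into a multiplicative one with constant C/m, and
expansion of Fⁿ says that Gⁿ contracts distances by l⁻ⁿ/D. Combining the two gives distortion
decaying like l^{-αn}. -/
lemma ExpandingLift.exists_inverse {p : ℕ} {α : ℝ} {f : T → T} {F F' : ℝ → ℝ}
    (h : ExpandingLift p α f F F') (hp : 0 < p) (hα : 0 < α) :
    ∃ G G' : ℝ → ℝ, ContractingInverse p α F G G' := by
  have hp0 : (0 : ℝ) < p := by exact_mod_cast hp
  have hsurj := surjective_of_map_add_one hp0 h.continuous h.map_add_one
  set E := h.strictMono.orderIsoOfSurjective F hsurj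
  have hr : ∀ x, F (E.symm x) = x := fun x => E.apply_symm_apply x
  have hl : ∀ x, E.symm (F x) = x := fun x => E.symm_apply_apply x
  have hc : Continuous E.symm := E.symm.continuous
  have hadd : ∀ x, E.symm (x + p) = E.symm x + 1 := fun x =>
    h.strictMono.injective (by rw [hr, h.map_add_one, hr])
  have hcF := h.deriv_continuous
  refine ⟨E.symm, fun x => (F' (E.symm x))⁻¹, hr, hl, hadd, fun x => ?_, ?_, fun x => ?_,
    fun x => ?_, ?_⟩
  · exact HasDerivAt.of_local_left_inverse hc.continuousAt (h.hasDerivAt _) (h.deriv_pos _).ne'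
      (Filter.Eventually.of_forall hr)
  · exact (hcF.comp hc).inv₀ fun x => (h.deriv_pos _).ne'
  · exact inv_pos.2 (h.deriv_pos _)
  · rw [hadd, h.deriv_add_one]
  obtain ⟨m, M, hm, hb⟩ := h.deriv_bounds
  obtain ⟨C, hC, hhol⟩ := h.deriv_holder
  obtain ⟨D, l, hD, hl1, hexp⟩ := h.expanding
  have hl0 : 0 < l := by linarith
  have hcontr : ∀ (n : ℕ) (x y : ℝ), D * l ^ n * |E.symm^[n] x - E.symm^[n] y| ≤ |x - y| := by
    intro n x y
    have hinv : ∀ z, F^[n] (E.symm^[n] z) = z := fun z =>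
      (Function.RightInverse.iterate (f := F) (g := E.symm) hr n) z
    rcases le_total (E.symm^[n] y) (E.symm^[n] x) with hle | hle
    · have h1 := hexp n _ _ hle
      rw [hinv, hinv] at h1
      rw [abs_of_nonneg (sub_nonneg.2 hle)]
      exact h1.trans (le_abs_self _)
    · have h1 := hexp n _ _ hle
      rw [hinv, hinv] at h1
      rw [abs_sub_comm, abs_of_nonneg (sub_nonneg.2 hle), abs_sub_comm]
      exact h1.trans (le_abs_self _)
  set r : ℝ := (l⁻¹) ^ α with hrdef
  have hr1 : r < 1 := Real.rpow_lt_one (by positivity) (inv_lt_one_of_one_lt₀ hl1) hα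
  have hr0 : 0 ≤ r := by positivity
  -- The extra factor r appears because G' at Gⁿ(x) is 1/F' at Gⁿ⁺¹(x).
  refine ⟨C / m * (D⁻¹ ^ α * r), r, by positivity, hr0, hr1, fun n x y => ?_⟩
  have hFle : ∀ a b, F' a ≤ Real.exp (C / m * |a - b| ^ α) * F' b := by
    intro a b
    have h1 := (abs_le.1 (hhol a b)).2
    have h2 := Real.add_one_le_exp (C / m * |a - b| ^ α)
    have h3 := (hb b).1
    calc F' a ≤ F' b + C * |a - b| ^ α := by linarith
      _ = F' b + C / m * |a - b| ^ α * m := by field_simp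
      _ ≤ F' b + C / m * |a - b| ^ α * F' b := by gcongr
      _ = (C / m * |a - b| ^ α + 1) * F' b := by ring
      _ ≤ _ := by gcongr; exact (h.deriv_pos b).le
  have hkey : |E.symm^[n + 1] x - E.symm^[n + 1] y| ^ α ≤ D⁻¹ ^ α * r * r ^ n * |x - y| ^ α := by
    have h1 : |E.symm^[n + 1] x - E.symm^[n + 1] y| ≤ D⁻¹ * (l⁻¹) ^ (n + 1) * |x - y| := by
      rw [inv_pow, ← mul_inv, ← div_eq_inv_mul, le_div_iff₀ (by positivity), mul_comm]
      exact hcontr (n + 1) x y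
    calc _ ≤ (D⁻¹ * (l⁻¹) ^ (n + 1) * |x - y|) ^ α := by gcongr
      _ = _ := by
        rw [Real.mul_rpow (by positivity) (by positivity),
          Real.mul_rpow (by positivity) (by positivity), ← Real.rpow_pow_comm (by positivity),
          pow_succ, ← hrdef]
        ring
  rw [Function.iterate_succ_apply', Function.iterate_succ_apply'] at hkey
  -- The points are exchanged because G' is a reciprocal of F'.
  have h1 := hFle (E.symm (E.symm^[n] y)) (E.symm (E.symm^[n] x))
  rw [abs_sub_comm] at h1
  rw [inv_le_iff_one_le_mul₀ (h.deriv_pos _), mul_right_comm,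
    ← div_eq_mul_inv, le_div_iff₀ (h.deriv_pos _), one_mul]
  refine h1.trans (mul_le_mul_of_nonneg_right (Real.exp_le_exp.2 ?_) (h.deriv_pos _).le)
  calc _ ≤ C / m * (D⁻¹ ^ α * r * r ^ n * |x - y| ^ α) := by gcongr
    _ = _ := by ring

/-! ### The transfer operator and its fixed point -/

/-- The transfer operator, in terms of the inverse `G` of a lift of degree `p`. -/
def transfer (p : ℕ) (G G' u : ℝ → ℝ) (x : ℝ) : ℝ :=
  ∑ k ∈ Finset.range p, G' (x + k) * u (G (x + k))

lemma sum_range_mul_eq (φ : ℕ → ℝ) (m n : ℕ) :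
    ∑ k ∈ Finset.range (m * n), φ k =
      ∑ a ∈ Finset.range m, ∑ b ∈ Finset.range n, φ (a + m * b) := by
  induction n with
  | zero => simp
  | succ n ih =>
    rw [Nat.mul_succ, Finset.sum_range_add, ih, ← Finset.sum_add_distrib]
    exact Finset.sum_congr rfl fun a _ => by rw [Finset.sum_range_succ, add_comm a (m * n)]

/-- Pointwise limits along an ultrafilter finer than `atTop` exist for bounded sequences. -/
lemma exists_tendsto_hyperfilter {a : ℕ → ℝ} {b c : ℝ} (h : ∀ n, a n ∈ Set.Icc b c) :
    ∃ x, Filter.Tendsto a (Filter.hyperfilter ℕ) (nhds x) := by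
  obtain ⟨x, -, hx⟩ := isCompact_Icc.ultrafilter_le_nhds ((Filter.hyperfilter ℕ).map a)
    (by
      rw [Filter.le_principal_iff]
      exact Filter.Eventually.of_forall (f := (Filter.hyperfilter ℕ : Filter ℕ)) h)
  exact ⟨x, hx⟩

namespace ContractingInverse

variable {p : ℕ} {α : ℝ} {F G G' : ℝ → ℝ}

lemma map_add_mul (h : ContractingInverse p α F G G') (x : ℝ) (n : ℕ) :
    G (x + p * n) = G x + n := by
  induction n with
  | zero => simp
  | succ n ih => push_cast; rw [mul_add, mul_one, ← add_assoc, h.map_add, ih, add_assoc]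

lemma deriv_add_mul (h : ContractingInverse p α F G G') (x : ℝ) (n : ℕ) :
    G' (x + p * n) = G' x := by
  induction n with
  | zero => simp
  | succ n ih => push_cast; rw [mul_add, mul_one, ← add_assoc, h.deriv_add, ih]

lemma iterate_add_pow (h : ContractingInverse p α F G G') (n : ℕ) (x : ℝ) :
    G^[n] (x + (p : ℝ) ^ n) = G^[n] x + 1 := by
  induction n generalizing x with
  | zero => simp
  | succ n ih =>
    have := h.map_add_mul x (p ^ n)
    push_cast at this
    rw [Function.iterate_succ_apply, Function.iterate_succ_apply, pow_succ', this, ih]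

/-- The derivative of `Gⁿ`. -/
lemma hasDerivAt_iterate (h : ContractingInverse p α F G G') (n : ℕ) (x : ℝ) :
    HasDerivAt G^[n] (∏ i ∈ Finset.range n, G' (G^[i] x)) x := by
  induction n with
  | zero => simpa using hasDerivAt_id x
  | succ n ih =>
    rw [Function.iterate_succ', Finset.prod_range_succ, mul_comm]
    exact (h.hasDerivAt _).comp x ih

lemma exists_distortion (h : ContractingInverse p α F G G') : ∃ K : ℝ, 0 ≤ K ∧
    ∀ (n : ℕ) (x y : ℝ), ∏ i ∈ Finset.range n, G' (G^[i] x) ≤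
      Real.exp (K * |x - y| ^ α) * ∏ i ∈ Finset.range n, G' (G^[i] y) := by
  obtain ⟨c, r, hc, hr0, hr1, hd⟩ := h.distortion
  have hr2 : 0 < 1 - r := by linarith
  refine ⟨c * (1 - r)⁻¹, by positivity, fun n x y => ?_⟩
  calc _ ≤ ∏ i ∈ Finset.range n, (Real.exp (c * r ^ i * |x - y| ^ α) * G' (G^[i] y)) :=
        Finset.prod_le_prod (fun i _ => (h.deriv_pos _).le) fun i _ => hd i x y
    _ = Real.exp (c * (∑ i ∈ Finset.range n, r ^ i) * |x - y| ^ α) *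
        ∏ i ∈ Finset.range n, G' (G^[i] y) := by
      rw [Finset.prod_mul_distrib, ← Real.exp_sum, Finset.mul_sum, Finset.sum_mul]
    _ ≤ _ := by
      have : ∑ i ∈ Finset.range n, r ^ i ≤ (1 - r)⁻¹ := by
        rw [← tsum_geometric_of_lt_one hr0 hr1]
        exact (summable_geometric_of_lt_one hr0 hr1).sum_le_tsum _ fun i _ => by positivity
      have hpos : 0 ≤ ∏ i ∈ Finset.range n, G' (G^[i] y) :=
        Finset.prod_nonneg fun i _ => (h.deriv_pos _).le
      gcongr

/-- Shifting x by 1 permutes the inverse branches cyclically: the new last term, k = p, equals the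
old term k = 0 because G(x + p) = G(x) + 1. -/
lemma transfer_periodic (h : ContractingInverse p α F G G') {u : ℝ → ℝ}
    (hu : Function.Periodic u 1) : Function.Periodic (transfer p G G' u) 1 := by
  intro x
  set ψ : ℕ → ℝ := fun k => G' (x + k) * u (G (x + k)) with hψ
  have h1 : transfer p G G' u (x + 1) = ∑ k ∈ Finset.range p, ψ (k + 1) :=
    Finset.sum_congr rfl fun k _ => by simp only [hψ]; push_cast; rw [add_assoc, add_comm 1 (k : ℝ)]
  have h2 : ψ p = ψ 0 := by
    simp only [hψ, h.map_add, h.deriv_add, hu (G x), Nat.cast_zero, add_zero]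
  have h3 := Finset.sum_range_succ ψ p
  rw [Finset.sum_range_succ', h2] at h3
  rw [h1]
  exact add_right_cancel h3

/-- The density of the `n`-th image of Lebesgue measure. -/
lemma transfer_iterate_one (h : ContractingInverse p α F G G') (n : ℕ) (x : ℝ) :
    (transfer p G G')^[n] (fun _ => 1) x =
      ∑ k ∈ Finset.range (p ^ n), ∏ i ∈ Finset.range n, G' (G^[i] (x + k)) := by
  induction n generalizing x with
  | zero => simp
  | succ n ih =>
    rw [Function.iterate_succ_apply', pow_succ', sum_range_mul_eq]
    refine Finset.sum_congr rfl fun a _ => ?_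
    rw [ih, Finset.mul_sum]
    refine Finset.sum_congr rfl fun b _ => ?_
    push_cast
    rw [Finset.prod_range_succ', ← add_assoc, mul_comm]
    simp only [Function.iterate_zero, id, Function.iterate_succ_apply, h.map_add_mul,
      h.deriv_add_mul]

/-- By the mean value theorem each summand (Gⁿ)'(x + k) is, up to a factor exp(±K), the increment of
Gⁿ over [x + k, x + k + 1]. These increments add up to 1 because Gⁿ advances by 1 over length pⁿ.
The log-Hölder bound passes termwise through the sum. -/
lemma exists_transfer_iterate_bounds (h : ContractingInverse p α F G G') (hα : 0 < α) :
    ∃ K : ℝ, 0 ≤ K ∧ ∀ n : ℕ,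
      (∀ x, Real.exp (-K) ≤ (transfer p G G')^[n] (fun _ => 1) x ∧
        (transfer p G G')^[n] (fun _ => 1) x ≤ Real.exp K) ∧
      ∀ x y, (transfer p G G')^[n] (fun _ => 1) x ≤
        Real.exp (K * |x - y| ^ α) * (transfer p G G')^[n] (fun _ => 1) y := by
  obtain ⟨K, hK, hd⟩ := h.exists_distortion
  refine ⟨K, hK, fun n => ⟨fun x => ?_, fun x y => ?_⟩⟩
  · have htel : ∑ k ∈ Finset.range (p ^ n), (G^[n] (x + k + 1) - G^[n] (x + k)) = 1 := by
      have := Finset.sum_range_sub (fun k : ℕ => G^[n] (x + k)) (p ^ n)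
      push_cast at this
      rw [h.iterate_add_pow, add_zero] at this
      simp only [← add_assoc] at this
      rw [this]; ring
    have hk : ∀ k : ℕ,
        Real.exp (-K) * (G^[n] (x + k + 1) - G^[n] (x + k)) ≤
          ∏ i ∈ Finset.range n, G' (G^[i] (x + k)) ∧
        ∏ i ∈ Finset.range n, G' (G^[i] (x + k)) ≤
          Real.exp K * (G^[n] (x + k + 1) - G^[n] (x + k)) := by
      intro k
      obtain ⟨z, hz, hz'⟩ := exists_hasDerivAt_eq_slope G^[n] _ (lt_add_one (x + k))
        (fun y _ => (h.hasDerivAt_iterate n y).continuousAt.continuousWithinAt)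
        (fun y _ => h.hasDerivAt_iterate n y)
      rw [add_sub_cancel_left, div_one] at hz'
      rw [← hz']
      have hle : ∀ a b : ℝ, |a - b| ≤ 1 → ∏ i ∈ Finset.range n, G' (G^[i] a) ≤
          Real.exp K * ∏ i ∈ Finset.range n, G' (G^[i] b) := by
        intro a b hab
        refine (hd n a b).trans (mul_le_mul_of_nonneg_right (Real.exp_le_exp.2 ?_)
          (Finset.prod_nonneg fun i _ => (h.deriv_pos _).le))
        exact mul_le_of_le_one_right hK (Real.rpow_le_one (abs_nonneg _) hab hα.le)
      constructor
      · rw [Real.exp_neg, ← div_eq_inv_mul, div_le_iff₀ (Real.exp_pos K), mul_comm]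
        exact hle _ _ (abs_le.2 ⟨by linarith [hz.1], by linarith [hz.2]⟩)
      · exact hle _ _ (abs_le.2 ⟨by linarith [hz.2], by linarith [hz.1]⟩)
    rw [h.transfer_iterate_one]
    constructor
    · calc Real.exp (-K) = ∑ k ∈ Finset.range (p ^ n),
            Real.exp (-K) * (G^[n] (x + k + 1) - G^[n] (x + k)) := by
            rw [← Finset.mul_sum, htel, mul_one]
        _ ≤ _ := Finset.sum_le_sum fun k _ => (hk k).1
    · calc _ ≤ ∑ k ∈ Finset.range (p ^ n), Real.exp K * (G^[n] (x + k + 1) - G^[n] (x + k)) :=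
            Finset.sum_le_sum fun k _ => (hk k).2
        _ = _ := by rw [← Finset.mul_sum, htel, mul_one]
  · rw [h.transfer_iterate_one, h.transfer_iterate_one, Finset.mul_sum]
    refine Finset.sum_le_sum fun k _ => ?_
    simpa only [add_sub_add_right_eq_sub] using hd n (x + k) (y + k)

/-- A positive, periodic fixed point of the transfer operator whose logarithm is Hölder, obtained
as a limit of Cesàro means. -/
lemma exists_transfer_fixedPoint (h : ContractingInverse p α F G G') (hα : 0 < α) :
    ∃ u : ℝ → ℝ, ∃ K : ℝ, 0 ≤ K ∧ (∀ x, 0 < u x) ∧ (∀ x, u x ≤ Real.exp K) ∧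
      Function.Periodic u 1 ∧ (∀ x y, u x ≤ Real.exp (K * |x - y| ^ α) * u y) ∧
      ∀ x, transfer p G G' u x = u x := by
  obtain ⟨K, hK, hb⟩ := h.exists_transfer_iterate_bounds hα
  set v : ℕ → ℝ → ℝ := fun n => (transfer p G G')^[n] (fun _ => 1) with hv
  have hvp : ∀ n, Function.Periodic (v n) 1 := by
    intro n
    induction n with
    | zero => intro x; rfl
    | succ n ih => simp only [hv, Function.iterate_succ_apply']; exact h.transfer_periodic ih
  set w : ℕ → ℝ → ℝ := fun N x => (∑ n ∈ Finset.range (N + 1), v n x) / (N + 1 : ℝ) with hw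
  have hN : ∀ N : ℕ, (0 : ℝ) < N + 1 := fun N => by positivity
  have hwb : ∀ x N, w N x ∈ Set.Icc (Real.exp (-K)) (Real.exp K) := by
    intro x N
    constructor
    · rw [le_div_iff₀ (hN N)]
      have := Finset.card_nsmul_le_sum (Finset.range (N + 1)) (fun n => v n x) (Real.exp (-K))
        fun n _ => ((hb n).1 x).1
      simpa [mul_comm] using this
    · rw [div_le_iff₀ (hN N)]
      have := Finset.sum_le_card_nsmul (Finset.range (N + 1)) (fun n => v n x) (Real.exp K)
        fun n _ => ((hb n).1 x).2
      simpa [mul_comm] using this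
  -- Convergence along an ultrafilter is available at every x at once without passing to
  -- subsequences; all inequalities and the finite sum in `transfer` survive pointwise limits.
  choose u hu using fun x => exists_tendsto_hyperfilter (hwb x)
  refine ⟨u, K, hK, fun x => ?_, fun x => ?_, fun x => ?_, fun x y => ?_, fun x => ?_⟩
  · exact (Real.exp_pos _).trans_le (ge_of_tendsto' (hu x) fun N => (hwb x N).1)
  · exact le_of_tendsto' (hu x) fun N => (hwb x N).2
  · refine tendsto_nhds_unique (hu (x + 1)) ((hu x).congr fun N => ?_)
    simp only [hw]
    simp only [hvp _ x]
  · refine le_of_tendsto_of_tendsto' (hu x) ((hu y).const_mul _) fun N => ?_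
    simp only [hw]
    rw [← mul_div_assoc, Finset.mul_sum]
    exact div_le_div_of_nonneg_right (Finset.sum_le_sum fun n _ => (hb n).2 x y) (hN N).le
  · have h1 : Filter.Tendsto (fun N => transfer p G G' (w N) x) (Filter.hyperfilter ℕ)
        (nhds (transfer p G G' u x)) :=
      tendsto_finsetSum _ fun k _ => (hu _).const_mul _
    -- Applying the operator to a Cesàro mean shifts the index, so only the two end terms change, an
    -- O(1/N) error.
    have h2 : ∀ N, transfer p G G' (w N) x = w N x + (v (N + 1) x - v 0 x) / (N + 1 : ℝ) := by
      intro N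
      have h3 : transfer p G G' (w N) x =
          (∑ n ∈ Finset.range (N + 1), v (n + 1) x) / (N + 1 : ℝ) := by
        simp only [hv, Function.iterate_succ_apply']
        simp only [transfer, hw, hv]
        rw [Finset.sum_comm, Finset.sum_div]
        refine Finset.sum_congr rfl fun k _ => ?_
        rw [← Finset.mul_sum, mul_div_assoc]
      rw [h3, ← add_div]
      congr 1
      have h4 := Finset.sum_range_succ (fun n => v n x) (N + 1)
      rw [Finset.sum_range_succ'] at h4
      linarith
    have h3 : Filter.Tendsto (fun N : ℕ => (v (N + 1) x - v 0 x) / (N + 1 : ℝ))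
        (Filter.hyperfilter ℕ) (nhds 0) := by
      refine Filter.Tendsto.mono_left ?_ Nat.hyperfilter_le_atTop
      have h5 := (tendsto_one_div_add_atTop_nhds_zero_nat (𝕜 := ℝ)).const_mul (Real.exp K)
      rw [mul_zero] at h5
      refine squeeze_zero_norm (fun N => ?_) h5
      rw [Real.norm_eq_abs, abs_div, abs_of_pos (hN N), mul_one_div]
      refine div_le_div_of_nonneg_right ?_ (hN N).le
      have h6 := (hb (N + 1)).1 x
      have h7 := (hb 0).1 x
      have h8 := Real.exp_pos (-K)
      exact abs_le.2 ⟨by linarith, by linarith⟩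
    refine tendsto_nhds_unique h1 ?_
    simpa only [h2, add_zero] using (hu x).add h3

end ContractingInverse

/-! ### Integration on the circle and the invariant density -/

open scoped ENNReal

lemma continuous_coe : Continuous (fun x : ℝ => (x : T)) := AddCircle.continuous_mk' 1

lemma IsHolder.continuous {α : ℝ} (hα : 0 < α) {φ : T → ℝ} (h : IsHolder α φ) :
    Continuous φ := by
  obtain ⟨d, D, hd, -, -, hb⟩ := h
  refine continuous_iff_continuousAt.2 fun x => ?_
  rw [ContinuousAt, tendsto_iff_dist_tendsto_zero]
  have h1 : Filter.Tendsto (fun y => D * dist y x ^ α) (nhds x) (nhds 0) := by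
    have hc : Continuous fun y : T => D * dist y x ^ α :=
      continuous_const.mul ((continuous_id.dist continuous_const).rpow_const fun _ => Or.inr hα.le)
    simpa [Real.zero_rpow hα.ne'] using hc.tendsto x
  refine squeeze_zero' (Filter.Eventually.of_forall fun _ => dist_nonneg) ?_ h1
  filter_upwards [Metric.ball_mem_nhds x hd] with y hy
  exact hb y x hy

lemma exists_real_lifts (a b : T) : ∃ x y : ℝ, (x : T) = a ∧ (y : T) = b ∧ |x - y| = dist a b := by
  induction a using QuotientAddGroup.induction_on with | H x => ?_
  induction b using QuotientAddGroup.induction_on with | H y => ?_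
  refine ⟨x, y + round (x - y), rfl, coe_eq_coe_iff.2 ⟨round (x - y), rfl⟩, ?_⟩
  have : dist (x : T) (y : T) = |x - y - round (x - y)| := by
    rw [dist_eq_norm, ← AddCircle.coe_sub, UnitAddCircle.norm_eq]
  rw [sub_add_eq_sub_sub]
  exact this.symm

lemma densityMeasure_apply {ρ : T → ℝ} {A : Set T} (hA : MeasurableSet A) (t : ℝ) :
    densityMeasure ρ A = ∫⁻ x in Set.Ioc t (t + 1),
      A.indicator (fun _ => 1) (x : T) * ENNReal.ofReal (ρ x) := by
  rw [densityMeasure, withDensity_apply _ hA, ← lintegral_indicator hA,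
    ← UnitAddCircle.lintegral_preimage t]
  refine lintegral_congr fun x => ?_
  by_cases hx : (x : T) ∈ A <;> simp [hx]

lemma volume_apply {A : Set T} (hA : MeasurableSet A) (t : ℝ) :
    volume A = ∫⁻ x in Set.Ioc t (t + 1), A.indicator (fun _ => (1 : ℝ≥0∞)) (x : T) := by
  rw [UnitAddCircle.lintegral_preimage t, lintegral_indicator hA, lintegral_one,
    Measure.restrict_apply_univ]

lemma image_Ioc_of_strictMono_of_surjective {Φ : ℝ → ℝ} (hm : StrictMono Φ)
    (hs : Function.Surjective Φ) (a b : ℝ) : Φ '' Set.Ioc a b = Set.Ioc (Φ a) (Φ b) :=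
  (hm.orderIsoOfSurjective Φ hs).image_Ioc a b

/-- Change of variables along an increasing bijection of the line. -/
lemma setLIntegral_Ioc_comp {Φ Φ' : ℝ → ℝ} (hm : StrictMono Φ) (hs : Function.Surjective Φ)
    (hd : ∀ x, HasDerivAt Φ (Φ' x) x) (a b : ℝ) (φ : ℝ → ℝ≥0∞) :
    ∫⁻ y in Set.Ioc (Φ a) (Φ b), φ y = ∫⁻ x in Set.Ioc a b, ENNReal.ofReal (Φ' x) * φ (Φ x) := by
  rw [← image_Ioc_of_strictMono_of_surjective hm hs, lintegral_image_eq_lintegral_abs_deriv_mul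
    measurableSet_Ioc (fun x _ => (hd x).hasDerivWithinAt) hm.injective.injOn]
  refine lintegral_congr fun x => ?_
  rw [abs_of_nonneg]
  rw [← (hd x).deriv]
  exact hm.monotone.deriv_nonneg

lemma setLIntegral_Ioc_nat (n : ℕ) (φ : ℝ → ℝ≥0∞) :
    ∫⁻ x in Set.Ioc (0 : ℝ) n, φ x =
      ∑ k ∈ Finset.range n, ∫⁻ x in Set.Ioc (0 : ℝ) 1, φ (x + k) := by
  induction n with
  | zero => simp
  | succ n ih =>
    have h0 : (0 : ℝ) ≤ n := n.cast_nonneg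
    have h1 : (n : ℝ) ≤ (n + 1 : ℕ) := by push_cast; linarith
    rw [← Set.Ioc_union_Ioc_eq_Ioc h0 h1, lintegral_union measurableSet_Ioc
      (Set.Ioc_disjoint_Ioc_of_le le_rfl), ih, Finset.sum_range_succ]
    congr 1
    have h2 := setLIntegral_Ioc_comp (Φ := fun x => x + n) (Φ' := fun _ => 1)
      (fun a b hab => by simpa using hab) (fun y => ⟨y - n, by simp⟩)
      (fun x => (hasDerivAt_id x).add_const _) 0 1 φ
    simp only [zero_add, ENNReal.ofReal_one, one_mul] at h2
    push_cast
    rw [add_comm (n : ℝ) 1]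
    exact h2

lemma measurable_indicator_coe {A : Set T} (hA : MeasurableSet A) :
    Measurable fun x : ℝ => A.indicator (fun _ => (1 : ℝ≥0∞)) (x : T) :=
  (measurable_const.indicator hA).comp continuous_coe.measurable

/-- A fixed point of the transfer operator is the density of an invariant measure. -/
lemma densityMeasure_preimage_of_transfer {p : ℕ} {α : ℝ} {f : T → T} {F F' G G' : ℝ → ℝ}
    (h : ExpandingLift p α f F F') (hG : ContractingInverse p α F G G') (hfc : Continuous f)
    {ρ : T → ℝ} (hρc : Continuous ρ) (hρ : ∀ x, 0 < ρ x)
    (htr : ∀ x : ℝ, transfer p G G' (fun y => ρ y) x = ρ x) {A : Set T} (hA : MeasurableSet A) :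
    densityMeasure ρ (f ⁻¹' A) = densityMeasure ρ A := by
  have hGm : StrictMono G := strictMono_of_deriv_pos fun x => by
    rw [(hG.hasDerivAt x).deriv]; exact hG.deriv_pos x
  have hGs : Function.Surjective G := fun x => ⟨F x, hG.left_inv x⟩
  have hGc : Continuous G :=
    continuous_iff_continuousAt.2 fun x => (hG.hasDerivAt x).continuousAt
  have hG'c := hG.deriv_continuous
  have hp : G 0 + 1 = G p := by rw [← hG.map_add, zero_add]
  -- The fundamental interval (G(0), G(0) + 1] is the image under G of (0, p]; cutting the latter
  -- into unit intervals produces the p terms of the transfer operator.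
  rw [densityMeasure_apply (hA.preimage hfc.measurable) (G 0), hp,
    setLIntegral_Ioc_comp hGm hGs hG.hasDerivAt, setLIntegral_Ioc_nat,
    densityMeasure_apply hA 0, zero_add, ← lintegral_finsetSum]
  · refine lintegral_congr fun x => ?_
    rw [← htr x, transfer, ENNReal.ofReal_sum_of_nonneg
      fun k _ => (mul_pos (hG.deriv_pos _) (hρ _)).le, Finset.mul_sum]
    refine Finset.sum_congr rfl fun k _ => ?_
    have h1 : (f ⁻¹' A).indicator (fun _ => (1 : ℝ≥0∞)) (G (x + k) : T) =
        A.indicator (fun _ => 1) (x : T) := by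
      have h2 : f (G (x + k) : T) = (x : T) := by
        rw [← h.coe_lift, hG.right_inv]
        exact coe_eq_coe_iff.2 ⟨k, by simp⟩
      have h3 : (G (x + k) : T) ∈ f ⁻¹' A ↔ (x : T) ∈ A := by rw [Set.mem_preimage, h2]
      by_cases hx : (x : T) ∈ A
      · rw [Set.indicator_of_mem hx, Set.indicator_of_mem (h3.2 hx)]
      · rw [Set.indicator_of_notMem hx, Set.indicator_of_notMem (mt h3.1 hx)]
    rw [h1, ENNReal.ofReal_mul (hG.deriv_pos _).le]
    ring
  · intro k _
    refine Measurable.mul ?_ (Measurable.mul ?_ ?_)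
    · exact ENNReal.measurable_ofReal.comp (hG'c.comp (continuous_add_const _)).measurable
    · exact (measurable_indicator_coe (hA.preimage hfc.measurable)).comp
        (hGc.comp (continuous_add_const _)).measurable
    · exact ENNReal.measurable_ofReal.comp
        (hρc.comp (continuous_coe.comp (hGc.comp (continuous_add_const _)))).measurable

lemma densityMeasure_univ {ρ : T → ℝ} (hc : Continuous ρ) (hρ : ∀ x, 0 < ρ x) :
    densityMeasure ρ Set.univ = ENNReal.ofReal (∫ x in (0 : ℝ)..1, ρ x) := by
  have hc' : Continuous fun x : ℝ => ρ x := hc.comp continuous_coe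
  rw [densityMeasure_apply MeasurableSet.univ 0, intervalIntegral.integral_of_le zero_le_one,
    ofReal_integral_eq_lintegral_ofReal]
  · simp
  · exact hc'.integrableOn_Ioc
  · exact Filter.Eventually.of_forall fun x => (hρ x).le

/-- For |x - y| ≤ 1 the exponent is at most K, so exp(t) - 1 ≤ t exp(t) makes the multiplicative
bound additive. -/
lemma isHolder_of_log_holder {α K B : ℝ} (hα : 0 < α) (hK : 0 ≤ K) (hB0 : 0 < B) {ρ : T → ℝ}
    (hρ : ∀ x, 0 < ρ x) (hB : ∀ x, ρ x ≤ B)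
    (h : ∀ x y : ℝ, ρ x ≤ Real.exp (K * |x - y| ^ α) * ρ y) : IsHolder α ρ := by
  have hE := Real.exp_pos K
  have hle : ∀ x y : ℝ, |x - y| ≤ 1 →
      ρ (x : T) - ρ (y : T) ≤ B * ((K + 1) * Real.exp K) * |x - y| ^ α := by
    intro x y hxy
    have hs1 : |x - y| ^ α ≤ 1 := Real.rpow_le_one (abs_nonneg _) hxy hα.le
    have hs0 : 0 ≤ |x - y| ^ α := by positivity
    have hxy' := h x y
    generalize |x - y| ^ α = s at hs1 hs0 hxy' ⊢
    have hKs : Real.exp (K * s) ≤ Real.exp K :=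
      Real.exp_le_exp.2 (mul_le_of_le_one_right hK hs1)
    have hexp : Real.exp (K * s) - 1 ≤ K * s * Real.exp K := by
      have h1 := Real.add_one_le_exp (-(K * s))
      have h2 : Real.exp (-(K * s)) * Real.exp (K * s) = 1 := by rw [← Real.exp_add]; simp
      have h3 := mul_le_mul_of_nonneg_right h1 (Real.exp_pos (K * s)).le
      have h4 : K * s * Real.exp (K * s) ≤ K * s * Real.exp K := by gcongr
      linarith
    calc ρ (x : T) - ρ (y : T) ≤ (Real.exp (K * s) - 1) * ρ (y : T) := by linarith
      _ ≤ K * s * Real.exp K * ρ (y : T) := mul_le_mul_of_nonneg_right hexp (hρ y).le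
      _ ≤ K * s * Real.exp K * B := by gcongr; exact hB y
      _ = B * (K * Real.exp K) * s := by ring
      _ ≤ _ := by gcongr; linarith
  refine ⟨1 / 2, B * ((K + 1) * Real.exp K), by norm_num, by norm_num, by positivity,
    fun a b hab => ?_⟩
  obtain ⟨x, y, rfl, rfl, hxy⟩ := exists_real_lifts a b
  rw [← hxy] at hab ⊢
  have h1 := hle x y (by linarith)
  have h2 := hle y x (by rw [abs_sub_comm]; linarith)
  rw [abs_sub_comm y x] at h2
  exact abs_le.2 ⟨by linarith, by linarith⟩

/-- An expanding circle endomorphism has a positive Hölder invariant density. -/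
lemma ExpandingLift.exists_invariantDensity {p : ℕ} (hp : 0 < p) {α : ℝ} (hα : 0 < α) {f : T → T}
    {F F' : ℝ → ℝ} (h : ExpandingLift p α f F F') (hfc : Continuous f) :
    ∃ ρ : T → ℝ, IsInvariantDensity α f ρ := by
  obtain ⟨G, G', hG⟩ := h.exists_inverse hp hα
  obtain ⟨u, K, hK, hpos, hB, hper, hlog, htr⟩ := hG.exists_transfer_fixedPoint hα
  obtain ⟨v, hv⟩ : ∃ v : T → ℝ, ∀ x : ℝ, v x = u x := ⟨hper.lift, fun x => hper.lift_coe x⟩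
  have hvpos : ∀ a, 0 < v a := fun a => by
    obtain ⟨x, -, rfl, -⟩ := exists_real_lifts a a
    rw [hv]; exact hpos x
  have hvB : ∀ a, v a ≤ Real.exp K := fun a => by
    obtain ⟨x, -, rfl, -⟩ := exists_real_lifts a a
    rw [hv]; exact hB x
  have hvc : Continuous v := (isHolder_of_log_holder hα hK (Real.exp_pos K) hvpos hvB
    fun x y => by rw [hv, hv]; exact hlog x y).continuous hα
  set c : ℝ := ∫ x in (0 : ℝ)..1, v x with hcdef
  have hc : 0 < c := intervalIntegral.intervalIntegral_pos_of_pos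
    ((hvc.comp continuous_coe).intervalIntegrable 0 1) (fun x => hvpos x) one_pos
  have hρpos : ∀ a, 0 < v a / c := fun a => div_pos (hvpos a) hc
  have hρhol : IsHolder α fun a => v a / c := by
    refine isHolder_of_log_holder hα hK (div_pos (Real.exp_pos K) hc) hρpos
      (fun a => div_le_div_of_nonneg_right (hvB a) hc.le) fun x y => ?_
    rw [hv, hv, ← mul_div_assoc]
    exact div_le_div_of_nonneg_right (hlog x y) hc.le
  have hρc : Continuous fun a => v a / c := hvc.div_const c
  refine ⟨fun a => v a / c, hρpos, hρhol, ?_, fun A hA =>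
    densityMeasure_preimage_of_transfer h hG hfc hρc hρpos (fun x => ?_) hA⟩
  · rw [densityMeasure_univ hρc hρpos, intervalIntegral.integral_div, ← hcdef, div_self hc.ne',
      ENNReal.ofReal_one]
  · simp only [transfer, ← mul_div_assoc]
    rw [← Finset.sum_div, hv, ← htr x]
    simp only [transfer, hv]

/-! ### The density coordinate -/

/-- The primitive of a continuous positive probability density is a homeomorphism of the circle
that maps the measure with this density to Lebesgue measure. -/
lemma exists_densityCoordinate {ρ : T → ℝ} (hc : Continuous ρ) (hρ : ∀ x, 0 < ρ x)
    (h1 : densityMeasure ρ Set.univ = 1) :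
    ∃ h₀ : T ≃ₜ T, IsDensityCoordinate ρ h₀ ∧
      ∀ A, MeasurableSet A → densityMeasure ρ (h₀ ⁻¹' A) = volume A := by
  have hc' : Continuous fun x : ℝ => ρ x := hc.comp continuous_coe
  have hint : ∀ a b : ℝ, IntervalIntegrable (fun x : ℝ => ρ x) volume a b := fun a b =>
    hc'.intervalIntegrable a b
  set P : ℝ → ℝ := fun x => ∫ t in (0 : ℝ)..x, ρ (t : T) with hP
  have hd : ∀ x : ℝ, HasDerivAt P (ρ x) x := fun x =>
    intervalIntegral.integral_hasDerivAt_right (hint 0 x)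
      hc'.aestronglyMeasurable.stronglyMeasurableAtFilter hc'.continuousAt
  have hPc : Continuous P := continuous_iff_continuousAt.2 fun x => (hd x).continuousAt
  have hPm : StrictMono P := strictMono_of_deriv_pos fun x => by rw [(hd x).deriv]; exact hρ x
  have hper : Function.Periodic (fun x : ℝ => ρ x) 1 := fun x => by
    beta_reduce
    rw [show ((x + 1 : ℝ) : T) = x from AddCircle.coe_add_period 1 x]
  have hone : ∫ x in (0 : ℝ)..1, ρ x = 1 := by
    rw [densityMeasure_univ hc hρ] at h1
    exact ENNReal.ofReal_eq_one.1 h1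
  have hP1 : ∀ x, P (x + 1) = P x + 1 := by
    intro x
    have h2 := hper.intervalIntegral_add_eq x 0
    rw [zero_add, hone] at h2
    simp only [hP]
    rw [← intervalIntegral.integral_add_adjacent_intervals (hint 0 x) (hint x (x + 1)), h2]
  obtain ⟨h₀, hh⟩ := exists_homeomorph_of_lift hPc hPm hP1
  refine ⟨h₀, hh, fun A hA => ?_⟩
  have hA' : MeasurableSet (h₀ ⁻¹' A) := hA.preimage h₀.continuous.measurable
  rw [densityMeasure_apply hA' 0, volume_apply hA (P 0), ← hP1, setLIntegral_Ioc_comp hPm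
    (surjective_of_map_add_one one_pos hPc hP1) hd]
  refine lintegral_congr fun x => ?_
  rw [mul_comm, ← hh]
  rfl

/-! ### Bounded expansion of measure and balanced geometry -/

lemma ExpandingLift.exists_volume_image_le {p : ℕ} {α : ℝ} {f : T → T} {F F' : ℝ → ℝ}
    (h : ExpandingLift p α f F F') : ∃ L : ℝ, 0 < L ∧
      ∀ E : Set T, MeasurableSet E → MeasurableSet (f '' E) →
        volume (f '' E) ≤ ENNReal.ofReal L * volume E := by
  obtain ⟨m, M, hm, hb⟩ := h.deriv_bounds
  have hM : 0 < M := hm.trans_le ((hb 0).1.trans (hb 0).2)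
  have hlip : LipschitzWith M.toNNReal F :=
    lipschitzWith_of_nnnorm_deriv_le (fun x => (h.hasDerivAt x).differentiableAt) fun x => by
      rw [(h.hasDerivAt x).deriv, ← NNReal.coe_le_coe, coe_nnnorm, Real.norm_eq_abs,
        abs_of_pos (h.deriv_pos x), Real.coe_toNNReal _ hM.le]
      exact (hb x).2
  have hvolF : ∀ S : Set ℝ, volume (F '' S) ≤ ENNReal.ofReal M * volume S := by
    intro S
    have := hlip.hausdorffMeasure_image_le zero_le_one S
    rwa [hausdorffMeasure_real, ENNReal.rpow_one] at this
  refine ⟨(p + 1) * M, by positivity, fun E hE hfE => ?_⟩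
  have hvol : ∀ (A : Set T), MeasurableSet A → ∀ t : ℝ,
      volume A = volume ((fun x : ℝ => (x : T)) ⁻¹' A ∩ Set.Ioc t (t + 1)) := fun A hA t =>
    AddCircle.add_projection_respects_measure 1 t hA
  rw [hvol _ hfE (F 0), hvol _ hE 0]
  set S := (fun x : ℝ => (x : T)) ⁻¹' E ∩ Set.Ioc 0 (0 + 1) with hS
  -- F maps (0, 1] into (F(0), F(0) + p], so integer translates by 0, …, p bring everything over
  -- f(E) back to one unit interval; the count p + 1 is crude but only finiteness matters.
  have hsub : (fun x : ℝ => (x : T)) ⁻¹' (f '' E) ∩ Set.Ioc (F 0) (F 0 + 1) ⊆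
      ⋃ k ∈ Finset.range (p + 1), (fun y => y - (k : ℝ)) '' (F '' S) := by
    rintro y ⟨⟨a, ha, hay⟩, hy⟩
    obtain ⟨x, hx, rfl⟩ := AddCircle.eq_coe_Ioc (p := (1 : ℝ)) a
    rw [← h.coe_lift] at hay
    obtain ⟨n, hn⟩ := coe_eq_coe_iff.1 hay
    have hF0 : F 0 < F x := h.strictMono hx.1
    have hF1 : F x ≤ F 0 + p := by
      rw [← h.map_add_one, zero_add]; exact h.strictMono.monotone hx.2
    have hn0 : 0 ≤ n := by
      have : (-1 : ℝ) < n := by linarith [hy.2]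
      have : (-1 : ℤ) < n := by exact_mod_cast this
      omega
    have hnp : n < p + 1 := by
      have : (n : ℝ) < p + 1 := by linarith [hy.1]
      exact_mod_cast this
    lift n to ℕ using hn0
    refine Set.mem_biUnion (x := n) (by simpa using (by exact_mod_cast hnp : n < p + 1))
      ⟨F x, ⟨x, ⟨ha, by simpa using hx⟩, rfl⟩, ?_⟩
    rw [hn]; simp
  calc _ ≤ volume (⋃ k ∈ Finset.range (p + 1), (fun y => y - (k : ℝ)) '' (F '' S)) :=
        measure_mono hsub
    _ ≤ ∑ k ∈ Finset.range (p + 1), volume ((fun y => y - (k : ℝ)) '' (F '' S)) :=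
        measure_biUnion_finset_le _ _
    _ = (p + 1 : ℕ) * volume (F '' S) := by
        simp [sub_eq_add_neg, Set.image_add_right]
    _ ≤ (p + 1 : ℕ) * (ENNReal.ofReal M * volume S) := by gcongr; exact hvolF S
    _ = _ := by
        rw [ENNReal.ofReal_mul (by positivity), ← mul_assoc]
        congr 2
        rw [← Nat.cast_add_one, ENNReal.ofReal_natCast]

lemma ExpandingLift.exists_densityMeasure_image_le {p : ℕ} {α : ℝ} {f : T → T} {F F' : ℝ → ℝ}
    (h : ExpandingLift p α f F F') {ρ : T → ℝ} (hc : Continuous ρ) (hρ : ∀ x, 0 < ρ x) :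
    ∃ L : ℝ, 0 < L ∧ ∀ E : Set T, MeasurableSet E → MeasurableSet (f '' E) →
      densityMeasure ρ (f '' E) ≤ ENNReal.ofReal L * densityMeasure ρ E := by
  obtain ⟨L, hL, hvol⟩ := h.exists_volume_image_le
  obtain ⟨a, -, ha⟩ := isCompact_univ.exists_isMinOn Set.univ_nonempty hc.continuousOn
  obtain ⟨b, -, hb⟩ := isCompact_univ.exists_isMaxOn Set.univ_nonempty hc.continuousOn
  have hlo : ∀ E : Set T, MeasurableSet E →
      ENNReal.ofReal (ρ a) * volume E ≤ densityMeasure ρ E := fun E hE => by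
    rw [densityMeasure, withDensity_apply _ hE, ← setLIntegral_const]
    exact lintegral_mono fun x => ENNReal.ofReal_le_ofReal (ha (Set.mem_univ x))
  have hhi : ∀ E : Set T, MeasurableSet E →
      densityMeasure ρ E ≤ ENNReal.ofReal (ρ b) * volume E := fun E hE => by
    rw [densityMeasure, withDensity_apply _ hE, ← setLIntegral_const]
    exact lintegral_mono fun x => ENNReal.ofReal_le_ofReal (hb (Set.mem_univ x))
  have ha0 := hρ a
  have hb0 := hρ b
  refine ⟨ρ b * L / ρ a, by positivity, fun E hE hfE => ?_⟩
  calc _ ≤ ENNReal.ofReal (ρ b) * (ENNReal.ofReal L * volume E) :=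
        (hhi _ hfE).trans (by gcongr; exact hvol E hE hfE)
    _ = ENNReal.ofReal (ρ b * L / ρ a) * (ENNReal.ofReal (ρ a) * volume E) := by
        rw [← mul_assoc, ← mul_assoc, ← ENNReal.ofReal_mul hb0.le,
          ← ENNReal.ofReal_mul (by positivity), div_mul_cancel₀ _ ha0.ne']
    _ ≤ _ := by gcongr; exact hlo E hE

lemma continuous_pMap (p : ℕ) : Continuous (pMap p) := continuous_const_smul p

lemma isCompact_cylinder {p n : ℕ} (w : Fin n → Fin p) : IsCompact (cylinder p w) :=
  isCompact_Icc.image continuous_coe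

lemma leftEndpoint_prependLetter {p n : ℕ} (i : Fin p) (w : Fin n → Fin p) :
    leftEndpoint p (prependLetter i w) = ((i : ℕ) + leftEndpoint p w) / p := by
  simp only [leftEndpoint, prependLetter, Fin.sum_univ_succ, Fin.cons_zero, Fin.cons_succ,
    Fin.val_zero, Fin.val_succ, zero_add, pow_one, add_div, Finset.sum_div]
  congr 1
  exact Finset.sum_congr rfl fun k _ => by rw [div_div, ← pow_succ]

lemma pMap_image_cylinder {p n : ℕ} (hp : 0 < p) (i : Fin p) (w : Fin n → Fin p) :
    pMap p '' cylinder p (prependLetter i w) = cylinder p w := by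
  have hp0 : (0 : ℝ) < p := by exact_mod_cast hp
  have hmul : ∀ x : ℝ, pMap p (x : T) = ((p * x - (i : ℕ) : ℝ) : T) := fun x => by
    rw [pMap, ← AddCircle.coe_nsmul, nsmul_eq_mul]
    exact coe_eq_coe_iff.2 ⟨(i : ℕ), by push_cast; ring⟩
  have hlen : 1 / (p : ℝ) ^ (n + 1) = 1 / (p : ℝ) ^ n / p := by rw [pow_succ, div_div]
  rw [cylinder, cylinder, leftEndpoint_prependLetter, hlen, ← add_div, ← Set.image_comp]
  have hIcc : Set.Icc (leftEndpoint p w) (leftEndpoint p w + 1 / (p : ℝ) ^ n) =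
      (fun x : ℝ => p * x - (i : ℕ)) '' Set.Icc (((i : ℕ) + leftEndpoint p w) / p)
        (((i : ℕ) + leftEndpoint p w + 1 / (p : ℝ) ^ n) / p) := by
    ext y
    constructor
    · rintro ⟨h1, h2⟩
      refine ⟨(y + (i : ℕ)) / p, ⟨?_, ?_⟩, ?_⟩
      · exact (div_le_div_iff_of_pos_right hp0).2 (by linarith)
      · exact (div_le_div_iff_of_pos_right hp0).2 (by linarith)
      · field_simp; ring
    · rintro ⟨x, ⟨h1, h2⟩, rfl⟩
      rw [div_le_iff₀ hp0] at h1
      rw [le_div_iff₀ hp0] at h2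
      exact ⟨by linarith, by linarith⟩
  rw [hIcc, ← Set.image_comp]
  exact Set.image_congr fun x _ => hmul x

lemma IsFullNonatomicProbability.cylinder_pos {μ : Measure T} (hμ : IsFullNonatomicProbability μ)
    {p n : ℕ} (hp : 0 < p) (w : Fin n → Fin p) : 0 < μ (cylinder p w) := by
  have hlen : (0 : ℝ) < 1 / (p : ℝ) ^ n := by positivity
  refine (hμ.fullSupport ((fun x : ℝ => (x : T)) '' Set.Ioo (leftEndpoint p w)
    (leftEndpoint p w + 1 / (p : ℝ) ^ n)) ?_ ?_).trans_le
      (measure_mono (Set.image_mono Set.Ioo_subset_Icc_self))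
  · exact QuotientAddGroup.isOpenMap_coe _ isOpen_Ioo
  · exact (Set.nonempty_Ioo.2 (by linarith)).image _

/-- An invariant measure that `pMap p` expands by a bounded factor has balanced geometry. -/
lemma hasBalancedGeometry_of_image_le {p : ℕ} (hp : 2 ≤ p) {μ : Measure T}
    (hμ : IsFullNonatomicProbability μ) (hinv : IsPInvariant p μ) {L : ℝ} (hL : 0 < L)
    (h : ∀ E, IsCompact E → μ (pMap p '' E) ≤ ENNReal.ofReal L * μ E) :
    HasBalancedGeometry p μ := by
  have : IsProbabilityMeasure μ := ⟨hμ.probability⟩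
  have hp0 : 0 < p := by omega
  refine ⟨L⁻¹, inv_pos.2 hL, fun n _ w i => ?_⟩
  have hpos : 0 < μ.real (cylinder p (prependLetter i w)) :=
    ENNReal.toReal_pos (hμ.cylinder_pos hp0 _).ne' (measure_ne_top _ _)
  have hle : μ.real (cylinder p (prependLetter i w)) ≤ μ.real (cylinder p w) := by
    refine ENNReal.toReal_mono (measure_ne_top _ _) ?_
    rw [← hinv _ (isCompact_cylinder w).measurableSet]
    refine measure_mono ?_
    rw [← Set.image_subset_iff, pMap_image_cylinder hp0]
  -- Here p ≥ 2 enters: one sibling j ≠ i already bounds the whole sum from below.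
  have : Nontrivial (Fin p) := Fin.nontrivial_iff_two_le.2 hp
  obtain ⟨j, hj⟩ := exists_ne i
  have hj' : μ.real (cylinder p w) ≤ L * μ.real (cylinder p (prependLetter j w)) := by
    have h1 := h _ (isCompact_cylinder (prependLetter j w))
    rw [pMap_image_cylinder hp0] at h1
    have h2 := ENNReal.toReal_mono (ENNReal.mul_ne_top ENNReal.ofReal_ne_top (measure_ne_top _ _)) h1
    rwa [ENNReal.toReal_mul, ENNReal.toReal_ofReal hL.le] at h2
  have hsum : μ.real (cylinder p (prependLetter j w)) ≤
      ∑ k ∈ Finset.univ.erase i, μ.real (cylinder p (prependLetter k w)) :=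
    Finset.single_le_sum (f := fun k => μ.real (cylinder p (prependLetter k w)))
      (fun k _ => measureReal_nonneg) (Finset.mem_erase.2 ⟨hj, Finset.mem_univ j⟩)
  rw [le_div_iff₀ hpos, inv_mul_le_iff₀ hL]
  exact (hle.trans hj').trans (by gcongr)

lemma isFullNonatomicProbability_map_homeomorph (e : T ≃ₜ T) :
    IsFullNonatomicProbability (Measure.map e (volume : Measure T)) := by
  have he : Measurable e := e.continuous.measurable
  refine ⟨?_, fun x => ?_, fun U hU hne => ?_⟩
  · rw [Measure.map_apply he MeasurableSet.univ, Set.preimage_univ, UnitAddCircle.measure_univ]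
  · rw [Measure.map_apply he (measurableSet_singleton x), ← e.image_symm, Set.image_singleton,
      ← Metric.closedBall_zero, AddCircle.volume_closedBall]
    simp
  · rw [Measure.map_apply he hU.measurableSet]
    exact (hU.preimage e.continuous).measure_pos _ (hne.preimage e.surjective)

end CircleMaps

/-! ### Assembly -/

theorem mainTheorem3 (p : ℕ) (hp : 2 ≤ p) (α : ℝ) (hα0 : 0 < α) (hα1 : α ≤ 1)
    (f : T → T) (hf : IsCircleEndomorphism p f) (hfC : IsC1Holder α f) (hfE : IsExpanding f) :
    (∃ ρ : T → ℝ, IsInvariantDensity α f ρ) ∧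
    ∀ ρ : T → ℝ, IsInvariantDensity α f ρ →
      ∃ h₀ : T ≃ₜ T, IsDensityCoordinate ρ h₀ ∧
        ∃ g : T → T, g = h₀ ∘ f ∘ h₀.symm ∧
          (∀ A : Set T, MeasurableSet A →
            (volume : Measure T) (g ⁻¹' A) = (volume : Measure T) A) ∧
          (∃ h : T ≃ₜ T, g ∘ h = h ∘ pMap p) ∧
          ∀ h : T ≃ₜ T, g ∘ h = h ∘ pMap p →
            ∀ μ : Measure T, μ = Measure.map h.symm (volume : Measure T) →
              IsFullNonatomicProbability μ ∧ IsPInvariant p μ ∧ HasBalancedGeometry p μ := by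
  have hfc : Continuous f := hf.1.continuous
  have hp0 : 0 < p := by omega
  obtain ⟨F, F', hF⟩ := exists_expandingLift hp0 hα0 hf hfC hfE
  refine ⟨hF.exists_invariantDensity hp0 hα0 hfc, fun ρ hρ => ?_⟩
  have hρc := hρ.holder.continuous hα0
  obtain ⟨h₀, hh₀, hmeas⟩ := exists_densityCoordinate hρc hρ.pos hρ.probability
  obtain ⟨φ, hφ⟩ := hF.exists_conjugacy hp
  have hgc : Continuous (h₀ ∘ f ∘ h₀.symm) := by fun_prop
  have hg : ∀ A : Set T, MeasurableSet A →
      (volume : Measure T) ((h₀ ∘ f ∘ h₀.symm) ⁻¹' A) = (volume : Measure T) A := by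
    intro A hA
    have hA' : MeasurableSet (h₀ ⁻¹' A) := hA.preimage h₀.continuous.measurable
    rw [← hmeas _ (hA.preimage hgc.measurable), ← hmeas A hA, ← hρ.invariant _ hA']
    congr 1
    ext x
    simp
  refine ⟨h₀, hh₀, h₀ ∘ f ∘ h₀.symm, rfl, hg, ⟨φ.symm.trans h₀, funext fun x => ?_⟩, ?_⟩
  · have h1 := hφ (φ.symm x)
    rw [φ.apply_symm_apply] at h1
    simp [← h1]
  rintro h hconj μ rfl
  have hmap : ∀ A, MeasurableSet A →
      Measure.map h.symm (volume : Measure T) A = volume (h '' A) := fun A hA => by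
    rw [Measure.map_apply h.symm.continuous.measurable hA, ← h.image_eq_preimage_symm]
  have hfull := isFullNonatomicProbability_map_homeomorph h.symm
  have hinv : IsPInvariant p (Measure.map h.symm (volume : Measure T)) := by
    intro A hA
    have hA' : MeasurableSet (h.symm ⁻¹' A) := hA.preimage h.symm.continuous.measurable
    rw [Measure.map_apply h.symm.continuous.measurable hA,
      Measure.map_apply h.symm.continuous.measurable
        (hA.preimage (continuous_pMap p).measurable), ← hg _ hA']
    congr 1
    ext x
    have h1 := congrFun hconj (h.symm x)
    simp only [Function.comp_apply, Homeomorph.apply_symm_apply] at h1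
    simp only [Set.mem_preimage, Function.comp_apply, h1, Homeomorph.symm_apply_apply]
  refine ⟨hfull, hinv, ?_⟩
  obtain ⟨L, hL, himage⟩ := hF.exists_densityMeasure_image_le hρc hρ.pos
  refine hasBalancedGeometry_of_image_le hp hfull hinv hL fun E hE => ?_
  have hpE := hE.image (continuous_pMap p)
  have hB : IsCompact (h₀ ⁻¹' (h '' E)) := by
    rw [← h₀.image_symm]
    exact (hE.image h.continuous).image h₀.symm.continuous
  -- Both h and h₀ conjugate to g, so h₀⁻¹ ∘ h intertwines the p-action with f; the estimate for ν
  -- thus transfers to μ for an arbitrary h.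
  have himg : h₀ ⁻¹' (h '' (pMap p '' E)) = f '' (h₀ ⁻¹' (h '' E)) := by
    rw [← Set.image_comp, ← hconj, ← h₀.image_symm]
    simp only [← Set.image_comp]
    exact Set.image_congr fun x _ => by simp
  rw [hmap _ hpE.measurableSet, hmap _ hE.measurableSet,
    ← hmeas _ (hpE.image h.continuous).measurableSet,
    ← hmeas _ (hE.image h.continuous).measurableSet, himg]
  exact himage _ hB.measurableSet (hB.image hfc).measurableSet
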